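/- Let $M$ be a compact smooth manifold, let $\iota:M\to\mathbb R^m$ be any smooth embedding, and let $\Sigma=\mathbb C\cup\{\infty\}$ be the Riemann sphere. Let $k\in\mathbb N$ and $1\le p<\infty$ satisfy $k-\frac2p>1$. Let $G$ be $PSL(2,\mathbb C)$, acting on $\Sigma$ by Möbius transformations, or the subgroup of $PSL(2,\mathbb C)$ that fixes one given point, or each of two given distinct points, of $\Sigma$; $G$ carries its usual Lie group topology. Let $\mathcal M^*=\mathcal M^*_{k,p}(\Sigma,M)$ be the set of non-constant $L^p_k$-maps, that is, of non-constant continuous maps $f:\Sigma\to M$ for which $\iota\circ f$ lies in the Sobolev space $L^p_k(\Sigma,\mathbb R^m)$ of functions with weak derivatives up to order $k$ in $L^p$. Let $\|\cdot\|_{k,p}$ be the norm of that space (computed in a fixed finite atlas of $\Sigma$), and for $f\in\mathcal M^*$ and $\epsilon>0$ let $$U_\epsilon(f)=\{h\in\mathcal M^*:\ \|\iota\circ h-\iota\circ f\|_{k,p}<\epsilon\}.$$ Theorem 1.2. For every $f\in\mathcal M^*$ there exist $\epsilon>0$ and a compact set $K_f\subset G$ such that $h\circ g\notin U_\epsilon(f)$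 for all $h\in U_\epsilon(f)$ and all $g\in G\setminus K_f$. In particular, $f\circ g\notin U_\epsilon(f)$ for all $g\in G\setminus K_f$: outside $K_f$ the orbit of $f$ never returns to $U_\epsilon(f)$. -/

import Mathlib

open MeasureTheory Manifold
open scoped ENNReal ContDiff MatrixGroups

noncomputable section

/-! ### The Riemann sphere and its reparametrization groups -/

/-- The Riemann sphere `ℂ ∪ {∞}`. -/
abbrev RiemannSphere : Type := OnePoint ℂ

/-- The action of `PSL(2, ℂ)` on the Riemann sphere by Möbius transformations: the action on the
complex projective line, transported along the identification `z ↦ [z : 1]`, `∞ ↦ [1 : 0]`. -/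
instance mobiusAction : MulAction PSL(2, ℂ) RiemannSphere :=
  (OnePoint.equivProjectivization ℂ).mulAction PSL(2, ℂ)

/-- On a finite point the action is `z ↦ (a z + b) / (c z + d)`. -/
theorem mobiusAction_coe (A : SL(2, ℂ)) (z : ℂ) :
    ((A : PSL(2, ℂ)) • (z : RiemannSphere)) =
      if A 1 0 * z + A 1 1 = 0 then OnePoint.infty
      else (((A 0 0 * z + A 0 1) / (A 1 0 * z + A 1 1) : ℂ) : RiemannSphere) :=
  OnePoint.smul_some_eq_ite (g := (A : GL (Fin 2) ℂ)) (k := z)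

/-- At infinity the action is `∞ ↦ a / c`. -/
theorem mobiusAction_infty (A : SL(2, ℂ)) :
    ((A : PSL(2, ℂ)) • (OnePoint.infty : RiemannSphere)) =
      if A 1 0 = 0 then OnePoint.infty
      else ((A 0 0 / A 1 0 : ℂ) : RiemannSphere) :=
  OnePoint.smul_infty_eq_ite (A : GL (Fin 2) ℂ)

/-- The reparametrization groups of the sphere with zero, one or two (distinct) marked points:
the whole of `PSL(2, ℂ)`, or the subgroup fixing the marked point(s). -/
def IsReparametrizationGroup (G : Subgroup PSL(2, ℂ)) : Prop :=
  G = ⊤ ∨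
  (∃ x : RiemannSphere, G = MulAction.stabilizer PSL(2, ℂ) x) ∨
  (∃ x y : RiemannSphere, x ≠ y ∧
    G = MulAction.stabilizer PSL(2, ℂ) x ⊓ MulAction.stabilizer PSL(2, ℂ) y)

/-- The reparametrized map `h ∘ g`. -/
def reparam {M : Type*} (h : RiemannSphere → M) (g : PSL(2, ℂ)) : RiemannSphere → M :=
  fun z => h (g • z)

/-! ### Sobolev norms on plane domains -/

/-- The partial derivative `∂₁ᵃ ∂₂ᵇ φ` of a real function on `ℂ = ℝ²`. -/
def partialDeriv (a b : ℕ) (φ : ℂ → ℝ) : ℂ → ℝ :=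
  (fun ψ z => fderiv ℝ ψ z 1)^[a] ((fun ψ z => fderiv ℝ ψ z Complex.I)^[b] φ)

/-- `v` is a weak derivative `∂₁ᵃ ∂₂ᵇ u` of `u` on the set `Ω`. -/
structure HasWeakDeriv {E : Type*} [NormedAddCommGroup E] [NormedSpace ℝ E]
    (Ω : Set ℂ) (a b : ℕ) (u v : ℂ → E) : Prop where
  locallyIntegrable : LocallyIntegrableOn u Ω
  locallyIntegrable_deriv : LocallyIntegrableOn v Ω
  integral_eq : ∀ φ : ℂ → ℝ, ContDiff ℝ ∞ φ → HasCompactSupport φ → tsupport φ ⊆ Ω →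
    ∫ z in Ω, partialDeriv a b φ z • u z = (-1 : ℝ) ^ (a + b) • ∫ z in Ω, φ z • v z

/-- The `L^p` norm on `Ω` of the weak derivative `∂₁ᵃ ∂₂ᵇ u`, with value `⊤` if that weak
derivative does not exist. (The weak derivative is unique up to null sets, so that the infimum is
over equal numbers.) -/
def weakDerivENorm {E : Type*} [NormedAddCommGroup E] [NormedSpace ℝ E]
    (Ω : Set ℂ) (p : ℝ) (a b : ℕ) (u : ℂ → E) : ℝ≥0∞ :=
  ⨅ (v : ℂ → E) (_ : HasWeakDeriv Ω a b u v), eLpNorm v (ENNReal.ofReal p) (volume.restrict Ω)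

/-- The Sobolev norm of `u` on `Ω`: the sum of the `L^p` norms of all weak partial derivatives of
order at most `k`. It is finite exactly for `u ∈ W^{k,p}(Ω)`. -/
def planeSobolevENorm {E : Type*} [NormedAddCommGroup E] [NormedSpace ℝ E]
    (Ω : Set ℂ) (k : ℕ) (p : ℝ) (u : ℂ → E) : ℝ≥0∞ :=
  ∑ ab ∈ (Finset.range (k + 1) ×ˢ Finset.range (k + 1)).filter (fun ab => ab.1 + ab.2 ≤ k),
    weakDerivENorm Ω p ab.1 ab.2 u

/-! ### `L^p_k`-maps on the sphere -/

/-- The parametrization `w ↦ 1 / w`, `0 ↦ ∞`, of the sphere near infinity. -/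
def chartAtInfinity (w : ℂ) : RiemannSphere :=
  if w = 0 then OnePoint.infty else ((w⁻¹ : ℂ) : RiemannSphere)

/-- The `L^p_k` norm of a vector valued function on the sphere, computed in the two discs
`|z| < 2` and `|1 / z| < 2` that cover it. -/
def sobolevENorm {E : Type*} [NormedAddCommGroup E] [NormedSpace ℝ E]
    (k : ℕ) (p : ℝ) (u : RiemannSphere → E) : ℝ≥0∞ :=
  planeSobolevENorm (Metric.ball 0 2) k p (fun z : ℂ => u (z : RiemannSphere)) +
  planeSobolevENorm (Metric.ball 0 2) k p (fun w : ℂ => u (chartAtInfinity w))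

/-- The space `𝓜*_{k,p}(Σ, M)` of non-constant `L^p_k`-maps from the sphere to `M`, where
`ι : M → E` is an embedding in a vector space: the continuous maps `f`
for which `ι ∘ f` is of class `L^p_k`, and which are not constant. -/
def nonconstantMaps {M E : Type*} [TopologicalSpace M] [NormedAddCommGroup E] [NormedSpace ℝ E]
    (ι : M → E) (k : ℕ) (p : ℝ) : Set (RiemannSphere → M) :=
  {f | Continuous f ∧ sobolevENorm k p (fun z => ι (f z)) < ⊤ ∧ ∃ x y, f x ≠ f y}

/-- The neighbourhood `U_ε(f)` in `𝓜*_{k,p}(Σ, M)`: the ball of radius `ε` about `f` in the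
`L^p_k` norm. -/
def sobolevBall {M E : Type*} [TopologicalSpace M] [NormedAddCommGroup E] [NormedSpace ℝ E]
    (ι : M → E) (k : ℕ) (p : ℝ) (f : RiemannSphere → M) (ε : ℝ) : Set (RiemannSphere → M) :=
  {h | h ∈ nonconstantMaps ι k p ∧
    sobolevENorm k p (fun z => ι (h z) - ι (f z)) < ENNReal.ofReal ε}

end

/-!
The proof needs only the embedding of `L^p_k` in the continuous functions. As `k - 2/p > 1` forces
`k ≥ 2`, it follows from the elementary bound of a function on the plane by the `L¹` norm of
`∂₁∂₂` (`exists_norm_le_mul_integral_weakDeriv`, `exists_norm_le_of_sobolevENorm_lt`). Hence, for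
small `ε`, all `h` in `U_ε(f)` are uniformly close to `f`. If `h ∘ g` lies in `U_ε(f)` as well,
then `f ∘ g` is uniformly close to `f`, because both are close to `h ∘ g`.

It remains to see that `f ∘ g` is uniformly close to `f` only for `g` in a compact set
(`exists_bound_of_forall_norm_sub_le`). If this failed, there would be a sequence `gₙ`, represented
by matrices with unbounded entries, such that `f ∘ gₙ → f` uniformly. The matrices divided by their
norms accumulate at a nonzero singular matrix, so that along a subsequence `gₙ z` converges to one
point `y` for all finite `z` but at most one (`exists_subseq_tendsto_smul_coe`). Then `f z = f y`
on a dense set, and `f` is constant. The compact set is the set of elements of `G` with a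
representing matrix whose entries are bounded by a constant; it is compact since the
preimage of `G` in `SL(2, ℂ)` is closed
(`IsReparametrizationGroup.isCompact_boundedElements`).
-/

open Filter Topology

/-! ### Möbius transformations in homogeneous coordinates -/

theorem continuous_chartAtInfinity : Continuous chartAtInfinity := by
  rw [continuous_iff_continuousAt]
  intro w
  rcases eq_or_ne w 0 with rfl | hw
  · rw [← continuousWithinAt_compl_self, ContinuousWithinAt]
    have h : Tendsto (fun w : ℂ => ((w⁻¹ : ℂ) : RiemannSphere)) (𝓝[≠] 0)
        (𝓝 OnePoint.infty) := by
      refine OnePoint.tendsto_coe_infty.comp ?_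
      rw [coclosedCompact_eq_cocompact, ← Metric.cobounded_eq_cocompact]
      exact tendsto_inv₀_nhdsNE_zero
    have h0 : chartAtInfinity 0 = OnePoint.infty := if_pos rfl
    rw [h0]
    exact h.congr' (eventually_nhdsWithin_of_forall fun w hw => (if_neg hw).symm)
  · have h : ContinuousAt (fun w : ℂ => ((w⁻¹ : ℂ) : RiemannSphere)) w :=
      OnePoint.continuous_coe.continuousAt.comp (continuousAt_inv₀ hw)
    refine h.congr ?_
    filter_upwards [isOpen_ne.mem_nhds hw] with v hv using (if_neg hv).symm

/-- The point `[u : v]` of the Riemann sphere; junk value `∞` if `u = v = 0`. -/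
noncomputable def homogeneousPoint (u v : ℂ) : RiemannSphere :=
  if v = 0 then OnePoint.infty else ((u / v : ℂ) : RiemannSphere)

theorem smul_coe_eq_homogeneousPoint (A : SL(2, ℂ)) (z : ℂ) :
    (A : PSL(2, ℂ)) • (z : RiemannSphere) =
      homogeneousPoint (A 0 0 * z + A 0 1) (A 1 0 * z + A 1 1) :=
  mobiusAction_coe A z

theorem homogeneousPoint_eq_chartAtInfinity {u : ℂ} (hu : u ≠ 0) (v : ℂ) :
    homogeneousPoint u v = chartAtInfinity (v / u) := by
  by_cases hv : v = 0 <;> simp [homogeneousPoint, chartAtInfinity, hu, hv]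

theorem homogeneousPoint_mul {c : ℂ} (hc : c ≠ 0) (u v : ℂ) :
    homogeneousPoint (c * u) (c * v) = homogeneousPoint u v := by
  by_cases hv : v = 0 <;> simp [homogeneousPoint, hc, hv, mul_div_mul_left]

theorem homogeneousPoint_eq_of_mul_eq {u v u' v' : ℂ} (h : u ≠ 0 ∨ v ≠ 0) (h' : u' ≠ 0 ∨ v' ≠ 0)
    (heq : u * v' = u' * v) : homogeneousPoint u v = homogeneousPoint u' v' := by
  by_cases hv : v = 0
  · have hu : u ≠ 0 := h.resolve_right (not_not.2 hv)
    have hv' : v' = 0 := by simpa [hv, hu] using heq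
    simp [homogeneousPoint, hv, hv']
  · by_cases hv' : v' = 0
    · have hu' : u' ≠ 0 := h'.resolve_right (not_not.2 hv')
      simp [hv, hv', hu'] at heq
    · simp only [homogeneousPoint, hv, hv', if_false]
      rw [(div_eq_div_iff hv hv').2 heq]

theorem Filter.Tendsto.homogeneousPoint {α : Type*} {l : Filter α} {a b : α → ℂ} {u v : ℂ}
    (ha : Tendsto a l (𝓝 u)) (hb : Tendsto b l (𝓝 v)) (h : u ≠ 0 ∨ v ≠ 0) :
    Tendsto (fun t => homogeneousPoint (a t) (b t)) l (𝓝 (_root_.homogeneousPoint u v)) := by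
  by_cases hu : u = 0
  · have hv : v ≠ 0 := h.resolve_left (not_not.2 hu)
    have : Tendsto (fun t => ((a t / b t : ℂ) : RiemannSphere)) l
        (𝓝 ((u / v : ℂ) : RiemannSphere)) :=
      (OnePoint.continuous_coe.tendsto _).comp (ha.div hb hv)
    rw [_root_.homogeneousPoint, if_neg hv]
    refine this.congr' ?_
    filter_upwards [hb.eventually_ne hv] with t ht using (if_neg ht).symm
  · rw [homogeneousPoint_eq_chartAtInfinity hu]
    refine ((continuous_chartAtInfinity.tendsto _).comp (hb.div ha hu)).congr' ?_
    filter_upwards [ha.eventually_ne hu] with t ht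
      using (homogeneousPoint_eq_chartAtInfinity ht _).symm

/-! ### Compactness and closedness in `SL(2, ℂ)` -/

theorem isCompact_entries_le (R : ℝ) : IsCompact {A : SL(2, ℂ) | ∀ i j, ‖A i j‖ ≤ R} := by
  have h : IsCompact {B : Matrix (Fin 2) (Fin 2) ℂ | ∀ i j, ‖B i j‖ ≤ R} := by
    have h' : {B : Fin 2 → Fin 2 → ℂ | ∀ i j, ‖B i j‖ ≤ R} =
        Set.univ.pi fun _ => Set.univ.pi fun _ => Metric.closedBall (0 : ℂ) R := by
      ext B
      simp [Set.mem_pi]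
    exact h' ▸ isCompact_univ_pi fun _ => isCompact_univ_pi fun _ => isCompact_closedBall 0 R
  exact Matrix.SpecialLinearGroup.isClosedEmbedding_val.isCompact_preimage h

theorem isClosed_smul_eq_self (x : RiemannSphere) :
    IsClosed {A : SL(2, ℂ) | (A : PSL(2, ℂ)) • x = x} := by
  induction x using OnePoint.rec with
  | infty =>
    have : {A : SL(2, ℂ) | (A : PSL(2, ℂ)) • (OnePoint.infty : RiemannSphere) = OnePoint.infty} =
        {A : SL(2, ℂ) | A 1 0 = 0} := by
      ext A
      simp only [Set.mem_ofPred_eq, mobiusAction_infty]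
      split_ifs with h <;> simp [h]
    rw [this]
    exact isClosed_eq (by fun_prop) continuous_const
  | coe z =>
    have : {A : SL(2, ℂ) | (A : PSL(2, ℂ)) • (z : RiemannSphere) = z} =
        {A : SL(2, ℂ) | A 0 0 * z + A 0 1 = z * (A 1 0 * z + A 1 1)} := by
      ext A
      simp only [Set.mem_ofPred_eq, mobiusAction_coe]
      split_ifs with h
      · have hdet : A 0 0 * A 1 1 - A 0 1 * A 1 0 = 1 := by
          rw [← Matrix.det_fin_two, A.det_coe]
        simp only [OnePoint.infty_ne_coe, h, mul_zero, false_iff]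
        intro h'
        -- both homogeneous coordinates of `A • z` would vanish
        have : A 0 0 * A 1 1 - A 0 1 * A 1 0 = 0 := by
          by_cases h10 : A 1 0 = 0
          · have : A 1 1 = 0 := by simpa [h10] using h
            simp [this, h10]
          · linear_combination A 0 0 * h - A 1 0 * h'
        exact one_ne_zero (hdet.symm.trans this)
      · rw [OnePoint.coe_eq_coe, div_eq_iff h]
    rw [this]
    exact isClosed_eq (by fun_prop) (by fun_prop)

theorem IsReparametrizationGroup.isClosed_preimage {G : Subgroup PSL(2, ℂ)}
    (hG : IsReparametrizationGroup G) : IsClosed {A : SL(2, ℂ) | (A : PSL(2, ℂ)) ∈ G} := by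
  rcases hG with rfl | ⟨x, rfl⟩ | ⟨x, y, -, rfl⟩
  · simp
  · exact isClosed_smul_eq_self x
  · exact (isClosed_smul_eq_self x).inter (isClosed_smul_eq_self y)

/-- The elements of `G` that are represented by a matrix with entries bounded by `R`. -/
def boundedElements (G : Subgroup PSL(2, ℂ)) (R : ℝ) : Set G :=
  {g | ∃ A : SL(2, ℂ), (A : PSL(2, ℂ)) = g ∧ ∀ i j, ‖A i j‖ ≤ R}

theorem IsReparametrizationGroup.isCompact_boundedElements {G : Subgroup PSL(2, ℂ)}
    (hG : IsReparametrizationGroup G) (R : ℝ) : IsCompact (boundedElements G R) := by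
  rw [Subtype.isCompact_iff]
  have h := ((isCompact_entries_le R).inter_left hG.isClosed_preimage).image
    (QuotientGroup.continuous_mk (N := Subgroup.center SL(2, ℂ)))
  convert h using 1
  ext g
  constructor
  · rintro ⟨⟨g, hg⟩, ⟨A, rfl, hA⟩, rfl⟩
    exact ⟨A, ⟨hg, hA⟩, rfl⟩
  · rintro ⟨A, ⟨hg, hA⟩, rfl⟩
    exact ⟨⟨_, hg⟩, ⟨A, rfl, hA⟩, rfl⟩

/-! ### Divergent Möbius transformations -/

/-- If a sequence in `SL(2, ℂ)` is unbounded, then a subsequence of the Möbius transformations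
converges pointwise to a constant on `ℂ`, off at most one point: the rescaled matrices
accumulate at a nonzero singular matrix. -/
theorem exists_subseq_tendsto_smul_coe (A : ℕ → SL(2, ℂ))
    (hA : ∀ n : ℕ, ∃ i j, (n : ℝ) < ‖A n i j‖) :
    ∃ (y : RiemannSphere) (x : ℂ) (φ : ℕ → ℕ), StrictMono φ ∧ ∀ z : ℂ, z ≠ x →
      Tendsto (fun n => ((A (φ n) : SL(2, ℂ)) : PSL(2, ℂ)) • (z : RiemannSphere)) atTop (𝓝 y) := by
  let a : ℕ → Fin 2 → Fin 2 → ℂ := fun n i j => A n i j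
  have ha_lt : ∀ n : ℕ, (n : ℝ) < ‖a n‖ := fun n => by
    obtain ⟨i, j, hij⟩ := hA n
    exact hij.trans_le ((norm_le_pi_norm (a n i) j).trans (norm_le_pi_norm (a n) i))
  have ha_pos : ∀ n, 0 < ‖a n‖ := fun n => (Nat.cast_nonneg n).trans_lt (ha_lt n)
  let c : ℕ → ℂ := fun n => ((‖a n‖⁻¹ : ℝ) : ℂ)
  have hc_ne : ∀ n, c n ≠ 0 := fun n => by
    simpa [c] using norm_pos_iff.1 (ha_pos n)
  have hc_lim : Tendsto c atTop (𝓝 0) := by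
    have : Tendsto (fun n => ‖a n‖⁻¹) atTop (𝓝 0) :=
      (tendsto_atTop_mono (fun n => (ha_lt n).le) tendsto_natCast_atTop_atTop).inv_tendsto_atTop
    have h := (Complex.continuous_ofReal.tendsto 0).comp this
    rw [Complex.ofReal_zero] at h
    exact h
  have hb_mem : ∀ n, c n • a n ∈ Metric.sphere (0 : Fin 2 → Fin 2 → ℂ) 1 := fun n => by
    simp [c, norm_smul, (ha_pos n).ne']
  obtain ⟨b, hb, φ, hφ, hlim⟩ := (isCompact_sphere _ _).tendsto_subseq hb_mem
  have hlim' : ∀ i j, Tendsto (fun n => c (φ n) * A (φ n) i j) atTop (𝓝 (b i j)) := fun i j =>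
    ((tendsto_pi_nhds.1 (tendsto_pi_nhds.1 hlim i)) j)
  have hdet : b 0 0 * b 1 1 - b 0 1 * b 1 0 = 0 := by
    refine tendsto_nhds_unique (((hlim' 0 0).mul (hlim' 1 1)).sub ((hlim' 0 1).mul (hlim' 1 0))) ?_
    have h2 : Tendsto (fun n => c (φ n) ^ 2) atTop (𝓝 0) := by
      simpa using (hc_lim.comp hφ.tendsto_atTop).pow 2
    refine h2.congr fun n => ?_
    have : A (φ n) 0 0 * A (φ n) 1 1 - A (φ n) 0 1 * A (φ n) 1 0 = 1 := by
      rw [← Matrix.det_fin_two, (A (φ n)).det_coe]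
    linear_combination -(c (φ n)) ^ 2 * this
  let u : ℂ → ℂ := fun z => b 0 0 * z + b 0 1
  let v : ℂ → ℂ := fun z => b 1 0 * z + b 1 1
  have hb_ne : b ≠ 0 := by
    rintro rfl
    simp at hb
  -- the kernel of the limit matrix is at most a line, and represents the exceptional point `x`
  obtain ⟨x, hx⟩ : ∃ x, ∀ z, z ≠ x → u z ≠ 0 ∨ v z ≠ 0 := by
    by_contra! hcon
    -- two zeros of `z ↦ b (z, 1)` would force `b = 0`
    obtain ⟨z, -, hz⟩ := hcon 0
    obtain ⟨z', hzz', hz'⟩ := hcon z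
    have hne : z' - z ≠ 0 := sub_ne_zero.2 hzz'
    have h00 : b 0 0 = 0 := mul_right_cancel₀ hne (by linear_combination hz'.1 - hz.1)
    have h10 : b 1 0 = 0 := mul_right_cancel₀ hne (by linear_combination hz'.2 - hz.2)
    have h01 : b 0 1 = 0 := by simpa [u, h00] using hz.1
    have h11 : b 1 1 = 0 := by simpa [v, h10] using hz.2
    refine hb_ne ?_
    ext i j
    fin_cases i <;> fin_cases j <;> assumption
  refine ⟨homogeneousPoint (u (x + 1)) (v (x + 1)), x, φ, hφ, fun z hz => ?_⟩
  have hy : homogeneousPoint (u z) (v z) = homogeneousPoint (u (x + 1)) (v (x + 1)) := by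
    refine homogeneousPoint_eq_of_mul_eq (hx z hz) (hx _ (by simp)) ?_
    simp only [u, v]
    linear_combination (z - (x + 1)) * hdet
  rw [← hy]
  have hu : Tendsto (fun n => c (φ n) * (A (φ n) 0 0 * z + A (φ n) 0 1)) atTop (𝓝 (u z)) :=
    (((hlim' 0 0).mul_const z).add (hlim' 0 1)).congr fun n => by ring
  have hv : Tendsto (fun n => c (φ n) * (A (φ n) 1 0 * z + A (φ n) 1 1)) atTop (𝓝 (v z)) :=
    (((hlim' 1 0).mul_const z).add (hlim' 1 1)).congr fun n => by ring
  refine (hu.homogeneousPoint hv (hx z hz)).congr fun n => ?_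
  rw [homogeneousPoint_mul (hc_ne _), smul_coe_eq_homogeneousPoint]

/-- A non-constant continuous map on the sphere is moved by a definite amount by all Möbius
transformations that are not represented by a matrix with small entries. -/
theorem exists_bound_of_forall_norm_sub_le {E : Type*} [NormedAddCommGroup E]
    {F : RiemannSphere → E} (hF : Continuous F) (hne : ∃ x y, F x ≠ F y) :
    ∃ η : ℝ, 0 < η ∧ ∃ R : ℝ, ∀ A : SL(2, ℂ),
      (∀ z, ‖F ((A : PSL(2, ℂ)) • z) - F z‖ ≤ η) → ∀ i j, ‖A i j‖ ≤ R := by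
  by_contra! hcon
  choose! A hA hR using fun n : ℕ => hcon (1 / ((n : ℝ) + 1)) Nat.one_div_pos_of_nat n
  obtain ⟨y, x, φ, hφ, hlim⟩ := exists_subseq_tendsto_smul_coe A hR
  have hconst : ∀ z : ℂ, z ≠ x → F z = F y := fun z hz => by
    have h1 : Tendsto (fun n => F (((A (φ n) : SL(2, ℂ)) : PSL(2, ℂ)) • (z : RiemannSphere)) - F z)
        atTop (𝓝 (F y - F z)) := ((hF.tendsto y).comp (hlim z hz)).sub_const _
    have h2 : Tendsto (fun n => F (((A (φ n) : SL(2, ℂ)) : PSL(2, ℂ)) • (z : RiemannSphere)) - F z)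
        atTop (𝓝 0) := squeeze_zero_norm (fun n => hA (φ n) z)
          (tendsto_one_div_add_atTop_nhds_zero_nat.comp hφ.tendsto_atTop)
    exact (sub_eq_zero.1 (tendsto_nhds_unique h1 h2)).symm
  have hdense : Dense ((↑) '' ({x}ᶜ : Set ℂ) : Set RiemannSphere) :=
    (OnePoint.denseRange_coe (X := ℂ)).dense_image OnePoint.continuous_coe (dense_compl_singleton x)
  have hall : F = fun _ => F y := hF.ext_on hdense continuous_const (by
    rintro _ ⟨z, hz, rfl⟩
    exact hconst z hz)
  obtain ⟨s, t, hst⟩ := hne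
  exact hst (by rw [hall])

/-! ### Test functions -/

theorem ContDiff.fderiv_apply_const {φ : ℂ → ℝ} (hφ : ContDiff ℝ ∞ φ) (w : ℂ) :
    ContDiff ℝ ∞ fun z => fderiv ℝ φ z w :=
  (hφ.fderiv_right (by simp)).clm_apply contDiff_const

theorem fderiv_mul_apply {φ ψ : ℂ → ℝ} (hφ : ContDiff ℝ ∞ φ) (hψ : ContDiff ℝ ∞ ψ) (z w : ℂ) :
    fderiv ℝ (fun z => φ z * ψ z) z w = fderiv ℝ φ z w * ψ z + φ z * fderiv ℝ ψ z w := by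
  rw [fderiv_fun_mul (hφ.differentiable (by simp) z) (hψ.differentiable (by simp) z)]
  simp
  ring

theorem contDiff_mul_re_im {F₁ F₂ : ℝ → ℝ} (h₁ : ContDiff ℝ ∞ F₁) (h₂ : ContDiff ℝ ∞ F₂) :
    ContDiff ℝ ∞ fun z : ℂ => F₁ z.re * F₂ z.im :=
  (h₁.comp Complex.reCLM.contDiff).mul (h₂.comp Complex.imCLM.contDiff)

theorem fderiv_mul_re_im_apply {F₁ F₂ : ℝ → ℝ} (h₁ : ContDiff ℝ ∞ F₁) (h₂ : ContDiff ℝ ∞ F₂)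
    (z w : ℂ) : fderiv ℝ (fun z : ℂ => F₁ z.re * F₂ z.im) z w =
      w.re * (deriv F₁ z.re * F₂ z.im) + w.im * (F₁ z.re * deriv F₂ z.im) := by
  have d₁ : HasFDerivAt (fun z : ℂ => F₁ z.re) (deriv F₁ z.re • Complex.reCLM) z :=
    (h₁.differentiable (by simp) z.re).hasDerivAt.comp_hasFDerivAt z Complex.reCLM.hasFDerivAt
  have d₂ : HasFDerivAt (fun z : ℂ => F₂ z.im) (deriv F₂ z.im • Complex.imCLM) z :=
    (h₂.differentiable (by simp) z.im).hasDerivAt.comp_hasFDerivAt z Complex.imCLM.hasFDerivAt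
  rw [(d₁.fun_mul d₂).fderiv]
  simp
  ring

/-- The product rule for `∂₁∂₂(χ G)` with `G z = F₁ (re z) * F₂ (im z)`, solved for the term
`χ ∂₁∂₂ G` in such a way that no derivative of `G` is left outside a total derivative. -/
theorem mul_deriv_mul_deriv_eq {χ : ℂ → ℝ} {F₁ F₂ : ℝ → ℝ} (hχ : ContDiff ℝ ∞ χ)
    (h₁ : ContDiff ℝ ∞ F₁) (h₂ : ContDiff ℝ ∞ F₂) (z : ℂ) :
    χ z * (deriv F₁ z.re * deriv F₂ z.im) =
      partialDeriv 1 1 (fun z => χ z * (F₁ z.re * F₂ z.im)) z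
      - partialDeriv 1 0 (fun z => partialDeriv 0 1 χ z * (F₁ z.re * F₂ z.im)) z
      - partialDeriv 0 1 (fun z => partialDeriv 1 0 χ z * (F₁ z.re * F₂ z.im)) z
      + partialDeriv 0 0 (fun z => partialDeriv 0 1 (partialDeriv 1 0 χ) z *
          (F₁ z.re * F₂ z.im)) z := by
  have hG := contDiff_mul_re_im h₁ h₂
  have h₂' : ContDiff ℝ ∞ (deriv F₂) := (contDiff_infty_iff_deriv.1 h₂).2
  have hG₂ := contDiff_mul_re_im h₁ h₂'
  have hχ₁ := hχ.fderiv_apply_const 1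
  have hχ₂ := hχ.fderiv_apply_const Complex.I
  have e : (fun z => fderiv ℝ (fun z => χ z * (F₁ z.re * F₂ z.im)) z Complex.I) =
      fun z => fderiv ℝ χ z Complex.I * (F₁ z.re * F₂ z.im) +
        χ z * (F₁ z.re * deriv F₂ z.im) := by
    ext z
    rw [fderiv_mul_apply hχ hG, fderiv_mul_re_im_apply h₁ h₂]
    simp
  simp only [partialDeriv, Function.iterate_one, Function.iterate_zero, id_eq]
  rw [e, fderiv_fun_add ((hχ₂.mul hG).differentiable (by simp) z)
    ((hχ.mul hG₂).differentiable (by simp) z), add_apply, fderiv_mul_apply hχ₂ hG,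
    fderiv_mul_apply hχ hG₂, fderiv_mul_apply hχ₁ hG, fderiv_mul_re_im_apply h₁ h₂,
    fderiv_mul_re_im_apply h₁ h₂, fderiv_mul_re_im_apply h₁ h₂']
  simp
  ring

theorem ContDiff.partialDeriv {φ : ℂ → ℝ} (hφ : ContDiff ℝ ∞ φ) (a b : ℕ) :
    ContDiff ℝ ∞ (partialDeriv a b φ) := by
  have iter : ∀ (w : ℂ) (n : ℕ) {ψ : ℂ → ℝ}, ContDiff ℝ ∞ ψ →
      ContDiff ℝ ∞ ((fun ψ z => fderiv ℝ ψ z w)^[n] ψ) := fun w n => by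
    induction n with
    | zero => exact id
    | succ n ih => exact fun h => ih (h.fderiv_apply_const w)
  exact iter _ _ (iter _ _ hφ)

theorem tsupport_partialDeriv_subset (a b : ℕ) (φ : ℂ → ℝ) :
    tsupport (partialDeriv a b φ) ⊆ tsupport φ := by
  have iter : ∀ (w : ℂ) (n : ℕ) (ψ : ℂ → ℝ),
      tsupport ((fun ψ z => fderiv ℝ ψ z w)^[n] ψ) ⊆ tsupport ψ := fun w n => by
    induction n with
    | zero => exact fun _ => subset_rfl
    | succ n ih => exact fun ψ => (ih _).trans (tsupport_fderiv_apply_subset ℝ w)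
  exact (iter _ _ _).trans (iter _ _ _)

theorem HasCompactSupport.partialDeriv {φ : ℂ → ℝ} (hφ : HasCompactSupport φ) (a b : ℕ) :
    HasCompactSupport (partialDeriv a b φ) :=
  hφ.of_isClosed_subset (isClosed_tsupport _) (tsupport_partialDeriv_subset a b φ)

/-- A smooth mollifier on the line has a smooth primitive with values in `[-1, 1]`: a smoothed
Heaviside function. -/
theorem ContDiffBump.exists_primitive_normed {c : ℝ} (ρ : ContDiffBump c) :
    ∃ F : ℝ → ℝ, ContDiff ℝ ∞ F ∧ deriv F = ρ.normed volume ∧ ∀ t, |F t| ≤ 1 := by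
  have hρ : ContDiff ℝ ∞ (ρ.normed volume) := ρ.contDiff_normed
  have hd : ∀ t, HasDerivAt (fun t => ∫ s in c..t, ρ.normed volume s) (ρ.normed volume t) t :=
    fun t => hρ.continuous.integral_hasStrictDerivAt c t |>.hasDerivAt
  have hd' : deriv (fun t => ∫ s in c..t, ρ.normed volume s) = ρ.normed volume :=
    funext fun t => (hd t).deriv
  refine ⟨_, contDiff_infty_iff_deriv.2 ⟨fun t => (hd t).differentiableAt, by rwa [hd']⟩, hd', ?_⟩
  intro t
  rw [← Real.norm_eq_abs]
  refine intervalIntegral.norm_integral_le_integral_norm_uIoc.trans ?_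
  refine (setIntegral_le_integral ρ.integrable_normed.norm
    (Eventually.of_forall fun _ => norm_nonneg _)).trans_eq ?_
  simp_rw [Real.norm_of_nonneg (ρ.nonneg_normed _), ρ.integral_normed]

theorem integral_mul_re_im (f g : ℝ → ℝ) :
    ∫ z : ℂ, f z.re * g z.im = (∫ x, f x) * ∫ y, g y := by
  rw [← integral_prod_mul]
  exact Complex.volume_preserving_equiv_real_prod.integral_comp
    Complex.measurableEquivRealProd.measurableEmbedding fun q => f q.1 * g q.2

/-! ### The Sobolev inequality -/

section Sobolev

variable {E : Type*} [NormedAddCommGroup E] [NormedSpace ℝ E]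

theorem HasWeakDeriv.norm_integral_le {Ω : Set ℂ} {a b : ℕ} {u v : ℂ → E} {φ : ℂ → ℝ} {C : ℝ}
    (h : HasWeakDeriv Ω a b u v) (hv : IntegrableOn v Ω) (hφ : ContDiff ℝ ∞ φ)
    (hc : HasCompactSupport φ) (hs : tsupport φ ⊆ Ω) (hC : ∀ z, |φ z| ≤ C) :
    ‖∫ z in Ω, partialDeriv a b φ z • u z‖ ≤ C * ∫ z in Ω, ‖v z‖ := by
  rw [h.integral_eq φ hφ hc hs, norm_smul, norm_pow, norm_neg, norm_one, one_pow, one_mul,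
    ← integral_const_mul]
  refine norm_integral_le_of_norm_le (hv.norm.const_mul C) (Eventually.of_forall fun z => ?_)
  rw [norm_smul]
  exact mul_le_mul_of_nonneg_right (hC z) (norm_nonneg _)

/-- Averages of a continuous function against product mollifiers approximate its values. -/
theorem exists_bump_norm_integral_sub_le [CompleteSpace E] {w : ℂ → E} (hw : Continuous w)
    (hc : HasCompactSupport w) (z₀ : ℂ) {η : ℝ} (hη : 0 < η) :
    ∃ (ρ₁ : ContDiffBump z₀.re) (ρ₂ : ContDiffBump z₀.im),
      ‖(∫ z : ℂ, (ρ₁.normed volume z.re * ρ₂.normed volume z.im) • w z) - w z₀‖ ≤ η := by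
  obtain ⟨δ, hδ, hwδ⟩ := Metric.continuousAt_iff.1 (hw.continuousAt (x := z₀)) η hη
  let ρ₁ : ContDiffBump z₀.re := ⟨δ / 4, δ / 2, by positivity, by linarith⟩
  let ρ₂ : ContDiffBump z₀.im := ⟨δ / 4, δ / 2, by positivity, by linarith⟩
  refine ⟨ρ₁, ρ₂, ?_⟩
  let κ : ℂ → ℝ := fun z => ρ₁.normed volume z.re * ρ₂.normed volume z.im
  have hκ1 : ∫ z, κ z = 1 := by
    rw [integral_mul_re_im, ρ₁.integral_normed, ρ₂.integral_normed, one_mul]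
  have hκi : Integrable κ := integrable_of_integral_eq_one hκ1
  have hκc : Continuous κ := (ρ₁.continuous_normed.comp Complex.continuous_re).mul
    (ρ₂.continuous_normed.comp Complex.continuous_im)
  have hκ0 : ∀ z, 0 ≤ κ z := fun z => mul_nonneg (ρ₁.nonneg_normed _) (ρ₂.nonneg_normed _)
  have hi : Integrable fun z => κ z • w z :=
    (hκc.smul hw).integrable_of_hasCompactSupport hc.smul_left
  have hsub : (∫ z, κ z • w z) - w z₀ = ∫ z, κ z • (w z - w z₀) := by
    simp_rw [smul_sub]
    rw [integral_sub hi (hκi.smul_const _), integral_smul_const, hκ1, one_smul]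
  change ‖(∫ z, κ z • w z) - w z₀‖ ≤ η
  rw [hsub]
  refine (norm_integral_le_of_norm_le (hκi.mul_const η) (Eventually.of_forall fun z => ?_)).trans_eq
    (by rw [integral_mul_const, hκ1, one_mul])
  rw [norm_smul, Real.norm_of_nonneg (hκ0 z)]
  by_cases hz : κ z = 0
  · simp [hz]
  · refine mul_le_mul_of_nonneg_left ?_ (hκ0 z)
    have hre : z.re ∈ Metric.ball z₀.re (δ / 2) := by
      rw [← ρ₁.support_normed_eq (μ := volume)]
      exact left_ne_zero_of_mul hz
    have him : z.im ∈ Metric.ball z₀.im (δ / 2) := by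
      rw [← ρ₂.support_normed_eq (μ := volume)]
      exact right_ne_zero_of_mul hz
    rw [Metric.mem_ball, Real.dist_eq] at hre him
    have hzz : dist z z₀ < δ := by
      rw [dist_eq_norm]
      refine (Complex.norm_le_abs_re_add_abs_im _).trans_lt ?_
      rw [Complex.sub_re, Complex.sub_im]
      linarith
    rw [← dist_eq_norm]
    exact (hwδ hzz).le

/-- The embedding of `W^{2,1}` in the bounded functions in dimension two, in an interior form:
on the unit disc, a continuous function is bounded by the `L¹` norms of its weak derivatives
`∂₁ᵃ∂₂ᵇ` with `a, b ≤ 1` on the disc of radius two. The functional `u ↦ u z₀` is the limit of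
pairings with `∂₁∂₂ G`, where `G` is a smoothed indicator function of a quadrant with corner
`z₀`, and after a cut-off the derivatives go over to `u`. -/
theorem exists_norm_le_mul_integral_weakDeriv [CompleteSpace E] :
    ∃ C : ℝ, 0 < C ∧ ∀ u v₁₁ v₁₀ v₀₁ v₀₀ : ℂ → E, Continuous u →
      HasWeakDeriv (Metric.ball 0 2) 1 1 u v₁₁ → IntegrableOn v₁₁ (Metric.ball 0 2) →
      HasWeakDeriv (Metric.ball 0 2) 1 0 u v₁₀ → IntegrableOn v₁₀ (Metric.ball 0 2) →
      HasWeakDeriv (Metric.ball 0 2) 0 1 u v₀₁ → IntegrableOn v₀₁ (Metric.ball 0 2) →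
      HasWeakDeriv (Metric.ball 0 2) 0 0 u v₀₀ → IntegrableOn v₀₀ (Metric.ball 0 2) →
      ∀ z₀ ∈ Metric.closedBall (0 : ℂ) 1, ‖u z₀‖ ≤ C *
        ((∫ z in Metric.ball 0 2, ‖v₁₁ z‖) + (∫ z in Metric.ball 0 2, ‖v₁₀ z‖) +
          (∫ z in Metric.ball 0 2, ‖v₀₁ z‖) + ∫ z in Metric.ball 0 2, ‖v₀₀ z‖) := by
  let χ : ContDiffBump (0 : ℂ) := ⟨1, 3 / 2, one_pos, by norm_num⟩
  have hχ : ContDiff ℝ ∞ χ := χ.contDiff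
  have hχc : HasCompactSupport χ := χ.hasCompactSupport
  have hχs : tsupport χ ⊆ Metric.ball 0 2 := by
    rw [χ.tsupport_eq]
    exact Metric.closedBall_subset_ball (by norm_num)
  have hχ₁ := hχ.partialDeriv 1 0
  have hχ₁s := tsupport_partialDeriv_subset 1 0 χ
  have hχ₁c := hχc.partialDeriv 1 0
  obtain ⟨C₁₁, hC₁₁⟩ := hχc.exists_bound_of_continuous hχ.continuous
  obtain ⟨C₁₀, hC₁₀⟩ := (hχc.partialDeriv 0 1).exists_bound_of_continuous
    (hχ.partialDeriv 0 1).continuous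
  obtain ⟨C₀₁, hC₀₁⟩ := hχ₁c.exists_bound_of_continuous hχ₁.continuous
  obtain ⟨C₀₀, hC₀₀⟩ := (hχ₁c.partialDeriv 0 1).exists_bound_of_continuous
    (hχ₁.partialDeriv 0 1).continuous
  let C := max 1 (max (max C₁₁ C₁₀) (max C₀₁ C₀₀))
  refine ⟨C, one_pos.trans_le (le_max_left _ _), ?_⟩
  intro u v₁₁ v₁₀ v₀₁ v₀₀ hu h₁₁ i₁₁ h₁₀ i₁₀ h₀₁ i₀₁ h₀₀ i₀₀ z₀ hz₀
  refine le_of_forall_pos_le_add fun η hη => ?_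
  have hwc : HasCompactSupport fun z => χ z • u z := hχc.smul_right
  obtain ⟨ρ₁, ρ₂, hρ⟩ := exists_bump_norm_integral_sub_le (hχ.continuous.smul hu) hwc z₀ hη
  obtain ⟨F₁, hF₁, hF₁', hF₁b⟩ := ρ₁.exists_primitive_normed
  obtain ⟨F₂, hF₂, hF₂', hF₂b⟩ := ρ₂.exists_primitive_normed
  have hG := contDiff_mul_re_im hF₁ hF₂
  have hGb : ∀ z : ℂ, |F₁ z.re * F₂ z.im| ≤ 1 := fun z => by
    rw [abs_mul]
    exact mul_le_one₀ (hF₁b _) (abs_nonneg _) (hF₂b _)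
  have hχz₀ : χ z₀ = 1 := χ.one_of_mem_closedBall hz₀
  -- each pairing of `u` with a derivative of a cut-off of `G` is bounded by a weak derivative
  have key : ∀ {a b : ℕ} {v : ℂ → E} {ψ : ℂ → ℝ} {D : ℝ},
      HasWeakDeriv (Metric.ball 0 2) a b u v → IntegrableOn v (Metric.ball 0 2) →
      ContDiff ℝ ∞ ψ → tsupport ψ ⊆ tsupport χ → (∀ z, ‖ψ z‖ ≤ D) → D ≤ C →
      IntegrableOn (fun z => partialDeriv a b (fun z => ψ z * (F₁ z.re * F₂ z.im)) z • u z)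
          (Metric.ball 0 2) ∧
        ‖∫ z in Metric.ball 0 2,
          partialDeriv a b (fun z => ψ z * (F₁ z.re * F₂ z.im)) z • u z‖ ≤
          C * ∫ z in Metric.ball 0 2, ‖v z‖ := by
    intro a b v ψ D h hv hψ hψs hD hDC
    have hs : tsupport (fun z => ψ z * (F₁ z.re * F₂ z.im)) ⊆ tsupport χ :=
      (tsupport_mul_subset_left (f := ψ)).trans hψs
    have hc : HasCompactSupport fun z => ψ z * (F₁ z.re * F₂ z.im) :=
      hχc.of_isClosed_subset (isClosed_tsupport _) hs
    refine ⟨?_, h.norm_integral_le hv (hψ.mul hG) hc (hs.trans hχs) fun z => ?_⟩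
    · exact (((hψ.mul hG).partialDeriv a b).continuous.smul hu).integrable_of_hasCompactSupport
        (hc.partialDeriv a b).smul_right |>.integrableOn
    · rw [abs_mul]
      exact (mul_le_of_le_one_right (abs_nonneg _) (hGb z)).trans ((hD z).trans hDC)
  obtain ⟨j₁₁, b₁₁⟩ := key h₁₁ i₁₁ hχ subset_rfl hC₁₁ (by simp [C])
  obtain ⟨j₁₀, b₁₀⟩ := key h₁₀ i₁₀ (hχ.partialDeriv 0 1) (tsupport_partialDeriv_subset 0 1 χ) hC₁₀
    (by simp [C])
  obtain ⟨j₀₁, b₀₁⟩ := key h₀₁ i₀₁ hχ₁ hχ₁s hC₀₁ (by simp [C])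
  obtain ⟨j₀₀, b₀₀⟩ := key h₀₀ i₀₀ (hχ₁.partialDeriv 0 1)
    ((tsupport_partialDeriv_subset 0 1 _).trans hχ₁s) hC₀₀ (by simp [C])
  have hint : ∫ z : ℂ, (ρ₁.normed volume z.re * ρ₂.normed volume z.im) • χ z • u z =
      ∫ z in Metric.ball 0 2, (χ z * (deriv F₁ z.re * deriv F₂ z.im)) • u z := by
    rw [hF₁', hF₂', setIntegral_eq_integral_of_forall_compl_eq_zero]
    · simp_rw [smul_smul, mul_comm]
    · intro z hz
      have : χ z = 0 := image_eq_zero_of_notMem_tsupport fun h => hz (hχs h)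
      simp [this]
  simp_rw [mul_deriv_mul_deriv_eq hχ hF₁ hF₂, add_smul, sub_smul] at hint
  have hsplit := integral_add' ((j₁₁.sub j₁₀).sub j₀₁) j₀₀
  rw [integral_sub' (j₁₁.sub j₁₀) j₀₁, integral_sub' j₁₁ j₁₀] at hsplit
  have htotal := hint.trans hsplit
  simp only [Pi.smul_apply', hχz₀, one_smul] at hρ
  rw [htotal] at hρ
  have hsum := (norm_add_le _ _).trans (add_le_add ((norm_sub_le _ _).trans
    (add_le_add ((norm_sub_le _ _).trans (add_le_add b₁₁ b₁₀)) b₀₁)) b₀₀)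
  rw [norm_sub_rev] at hρ
  have hu₀ := (norm_sub_norm_le _ _).trans hρ
  linarith

end Sobolev

section SphereBound

variable {E : Type*} [NormedAddCommGroup E] [NormedSpace ℝ E]

/-- On a disc, which has finite measure, a bound of the `L^p` norm gives one of the `L¹` norm. -/
theorem exists_hasWeakDeriv_integral_norm_le {p : ℝ} (hp : 1 ≤ p) :
    ∃ c : ℝ, 0 ≤ c ∧ ∀ (a b : ℕ) (u : ℂ → E) (ε : ℝ), 0 ≤ ε →
      weakDerivENorm (Metric.ball 0 2) p a b u < ENNReal.ofReal ε →
      ∃ v, HasWeakDeriv (Metric.ball 0 2) a b u v ∧ IntegrableOn v (Metric.ball 0 2) ∧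
        ∫ z in Metric.ball 0 2, ‖v z‖ ≤ ε * c := by
  let μ : Measure ℂ := volume.restrict (Metric.ball 0 2)
  let c : ℝ≥0∞ := μ Set.univ ^ (1 / (1 : ℝ≥0∞).toReal - 1 / (ENNReal.ofReal p).toReal)
  have hμ : μ Set.univ ≠ ⊤ := by
    simpa [μ] using (measure_ball_lt_top (μ := volume) (x := (0 : ℂ)) (r := 2)).ne
  have hc : c ≠ ⊤ := by
    refine ENNReal.rpow_ne_top_of_nonneg ?_ hμ
    rw [ENNReal.toReal_ofReal (by linarith), ENNReal.toReal_one, sub_nonneg]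
    exact one_div_le_one_div_of_le one_pos hp
  refine ⟨c.toReal, ENNReal.toReal_nonneg, fun a b u ε hε h => ?_⟩
  obtain ⟨v, h⟩ := iInf_lt_iff.1 h
  obtain ⟨hv, h⟩ := iInf_lt_iff.1 h
  have hm : AEStronglyMeasurable v μ := hv.locallyIntegrable_deriv.aestronglyMeasurable
  have h1 : ∫⁻ z, ‖v z‖ₑ ∂μ ≤ ENNReal.ofReal ε * c := by
    rw [← eLpNorm_one_eq_lintegral_enorm]
    exact (eLpNorm_le_eLpNorm_mul_rpow_measure_univ (by simpa using hp) hm).trans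
      (mul_le_mul_left h.le _)
  have htop : ENNReal.ofReal ε * c ≠ ⊤ := ENNReal.mul_ne_top ENNReal.ofReal_ne_top hc
  refine ⟨v, hv, ⟨hm, h1.trans_lt htop.lt_top⟩, ?_⟩
  rw [integral_norm_eq_lintegral_enorm hm]
  refine (ENNReal.toReal_mono htop h1).trans_eq ?_
  rw [ENNReal.toReal_mul, ENNReal.toReal_ofReal hε]

theorem weakDerivENorm_le_planeSobolevENorm {Ω : Set ℂ} {k : ℕ} {p : ℝ} {a b : ℕ}
    (h : a + b ≤ k) (u : ℂ → E) : weakDerivENorm Ω p a b u ≤ planeSobolevENorm Ω k p u :=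
  Finset.single_le_sum (f := fun ab : ℕ × ℕ => weakDerivENorm Ω p ab.1 ab.2 u)
    (fun _ _ => zero_le) (a := (a, b)) (by simp; omega)

theorem exists_norm_le_of_planeSobolevENorm_lt [CompleteSpace E] {k : ℕ} {p : ℝ} (hp : 1 ≤ p)
    (hk : 2 ≤ k) : ∃ C : ℝ, 0 ≤ C ∧ ∀ (u : ℂ → E) (ε : ℝ), 0 ≤ ε → Continuous u →
      planeSobolevENorm (Metric.ball 0 2) k p u < ENNReal.ofReal ε →
      ∀ z ∈ Metric.closedBall (0 : ℂ) 1, ‖u z‖ ≤ C * ε := by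
  obtain ⟨c, hc, hw⟩ := exists_hasWeakDeriv_integral_norm_le (E := E) hp
  obtain ⟨C, hC, hS⟩ := exists_norm_le_mul_integral_weakDeriv (E := E)
  refine ⟨C * (4 * c), by positivity, fun u ε hε hu h z hz => ?_⟩
  have hv : ∀ a b, a + b ≤ k → _ := fun a b hab =>
    hw a b u ε hε ((weakDerivENorm_le_planeSobolevENorm hab u).trans_lt h)
  obtain ⟨v₁₁, h₁₁, i₁₁, b₁₁⟩ := hv 1 1 (by omega)
  obtain ⟨v₁₀, h₁₀, i₁₀, b₁₀⟩ := hv 1 0 (by omega)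
  obtain ⟨v₀₁, h₀₁, i₀₁, b₀₁⟩ := hv 0 1 (by omega)
  obtain ⟨v₀₀, h₀₀, i₀₀, b₀₀⟩ := hv 0 0 (by omega)
  refine (hS u v₁₁ v₁₀ v₀₁ v₀₀ hu h₁₁ i₁₁ h₁₀ i₁₀ h₀₁ i₀₁ h₀₀ i₀₀ z hz).trans ?_
  rw [mul_assoc]
  exact mul_le_mul_of_nonneg_left (by linarith) hC.le

/-- The closed unit discs of the two charts cover the sphere. -/
theorem exists_mem_closedBall_chart (z : RiemannSphere) :
    ∃ w ∈ Metric.closedBall (0 : ℂ) 1, z = (w : RiemannSphere) ∨ z = chartAtInfinity w := by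
  induction z using OnePoint.rec with
  | infty => exact ⟨0, by simp, Or.inr (by simp [chartAtInfinity])⟩
  | coe z =>
    rcases le_total ‖z‖ 1 with h | h
    · exact ⟨z, by simpa using h, Or.inl rfl⟩
    · have hz : z ≠ 0 := norm_pos_iff.1 (one_pos.trans_le h)
      exact ⟨z⁻¹, by simpa using inv_le_one_of_one_le₀ h, Or.inr (by simp [chartAtInfinity, hz])⟩

/-- The Sobolev embedding of `L^p_k` of the sphere, `k ≥ 2`, in the continuous functions. -/
theorem exists_norm_le_of_sobolevENorm_lt [CompleteSpace E] {k : ℕ} {p : ℝ} (hp : 1 ≤ p)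
    (hk : 2 ≤ k) : ∃ C : ℝ, 0 ≤ C ∧ ∀ (u : RiemannSphere → E) (ε : ℝ), 0 ≤ ε → Continuous u →
      sobolevENorm k p u < ENNReal.ofReal ε → ∀ z, ‖u z‖ ≤ C * ε := by
  obtain ⟨C, hC, h⟩ := exists_norm_le_of_planeSobolevENorm_lt (E := E) hp hk
  refine ⟨C, hC, fun u ε hε hu hlt z => ?_⟩
  obtain ⟨w, hw, rfl | rfl⟩ := exists_mem_closedBall_chart z
  · exact h _ ε hε (hu.comp OnePoint.continuous_coe) (le_self_add.trans_lt hlt) w hw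
  · exact h _ ε hε (hu.comp continuous_chartAtInfinity) (le_add_self.trans_lt hlt) w hw

end SphereBound

/-! ### Reparametrized maps leave a Sobolev neighbourhood -/

theorem theorem1p2 {n m : ℕ} {M : Type*} [TopologicalSpace M] [T2Space M] [CompactSpace M]
    [ChartedSpace (EuclideanSpace ℝ (Fin n)) M] [IsManifold (𝓡 n) ∞ M]
    (ι : M → EuclideanSpace ℝ (Fin m)) (hι : IsSmoothEmbedding (𝓡 n) (𝓡 m) ∞ ι)
    (k : ℕ) (p : ℝ) (hp : 1 ≤ p) (hkp : 1 < (k : ℝ) - 2 / p)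
    (G : Subgroup PSL(2, ℂ)) (hG : IsReparametrizationGroup G)
    (f : RiemannSphere → M) (hf : f ∈ nonconstantMaps ι k p) :
    ∃ ε : ℝ, 0 < ε ∧ ∃ K : Set G, IsCompact K ∧
      (∀ h ∈ sobolevBall ι k p f ε, ∀ g : G, g ∉ K →
        reparam h g ∉ sobolevBall ι k p f ε) ∧
      (∀ g : G, g ∉ K → reparam f g ∉ sobolevBall ι k p f ε) := by
  have hk : 2 ≤ k := by
    have h2 : 0 < 2 / p := by positivity
    have h1 : (1 : ℝ) < k := by linarith
    exact_mod_cast h1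
  obtain ⟨hfc, -, x, y, hxy⟩ := hf
  have hιc : Continuous ι := hι.isEmbedding.continuous
  obtain ⟨η, hη, R, hR⟩ := exists_bound_of_forall_norm_sub_le (hιc.comp hfc)
    ⟨x, y, fun h => hxy (hι.isEmbedding.injective h)⟩
  obtain ⟨C, hC, hS⟩ := exists_norm_le_of_sobolevENorm_lt
    (E := EuclideanSpace ℝ (Fin m)) hp hk
  -- `ε` is so small that two maps in the ball are together uniformly `η`-close to `f`
  let ε : ℝ := η / (2 * (C + 1))
  have hε : 0 < ε := by positivity
  have hCε : C * ε ≤ η / 2 := by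
    have : (C + 1) * ε = η / 2 := by
      simp only [ε]
      field_simp
    linarith
  have hball : ∀ h ∈ sobolevBall ι k p f ε, ∀ z, ‖ι (h z) - ι (f z)‖ ≤ η / 2 :=
    fun h hh z => (hS _ ε hε.le ((hιc.comp hh.1.1).sub (hιc.comp hfc)) hh.2 z).trans hCε
  have main : ∀ h : RiemannSphere → M, (∀ z, ‖ι (h z) - ι (f z)‖ ≤ η / 2) → ∀ g : G,
      g ∉ boundedElements G R → reparam h g ∉ sobolevBall ι k p f ε := by
    intro h hh g hg hmem
    obtain ⟨A, hA⟩ := QuotientGroup.mk_surjective (g : PSL(2, ℂ))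
    refine hg ⟨A, hA, hR A fun z => ?_⟩
    have h1 := hball _ hmem z
    have h2 := hh ((A : PSL(2, ℂ)) • z)
    rw [reparam, ← hA] at h1
    rw [norm_sub_rev] at h2
    exact (norm_sub_le_norm_sub_add_norm_sub _ _ _).trans ((add_le_add h2 h1).trans (by linarith))
  refine ⟨ε, hε, boundedElements G R, hG.isCompact_boundedElements R,
    fun h hh => main h (hball h hh), main f fun z => ?_⟩
  simpa using (half_pos hη).le
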